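/- Let $A$ and $B$ be $C^*$-algebras, let $X$ be a (right) Hilbert $A$-module and $Y$ a (right) Hilbert $B$-module. Inner products are conjugate linear in the first variable. Let $\mathcal L(Y)$ be the $C^*$-algebra of adjointable operators on $Y$ and $\mathcal K(Y)\subseteq\mathcal L(Y)$ the closed linear span of the operators $\theta_{\xi,\eta}(\zeta)=\xi\cdot\langle\eta,\zeta\rangle$, and similarly for $X$. Let $M(Y)=\mathcal L(B,Y)$ be the space of adjointable operators from the Hilbert $B$-module $B$ to $Y$, with the right action of the multiplier algebra $M(B)=\mathcal L(B)$ by composition and the $M(B)$-valued inner product $\langle m,n\rangle=m^*n$; embed $Y$ in $M(Y)$ by $y\mapsto T_y$, $T_y(b)=y\cdot b$. For $m,n\in M(Y)$ regard $mn^*\in\mathcal L(Y)$ as an element of the multiplier algebra $M(\mathcal K(Y))=\mathcal L(Y)$. Let $(\psi,\rho)\colon(X,A)\to(M(Y),M(B))$ be a correspondence homomorphism, that is, $\psi\colon X\to M(Y)$ is a linear map and $\rho\colon A\to M(B)$ is a $*$-homomorphism such that $$\psi(\xi\cdot a)=\psi(\xi)\cdot\rho(a),\qquad \rho(\langle\xi,\eta\rangle)=\langle\psi(\xi),\psi(\eta)\rangle\qquad(\xi,\eta\in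 X,\ a\in A).$$ Then there is a unique $*$-homomorphism $\psi^{(1)}\colon\mathcal K(X)\to M(\mathcal K(Y))$ such that $$\psi^{(1)}(\theta_{\xi,\eta})=\psi(\xi)\psi(\eta)^*\qquad\text{for all }\xi,\eta\in X.$$ If moreover $\psi(X)\subseteq Y$, then $\psi^{(1)}(\mathcal K(X))\subseteq\mathcal K(Y)$ and $\psi^{(1)}(\theta_{\xi,\eta})=\theta_{\psi(\xi),\psi(\eta)}$ for all $\xi,\eta\in X$. -/

import Mathlib

open MulOpposite
open scoped MultiplierAlgebra

namespace HilbertMod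

/-!
Conventions. Mathlib's class `CStarModule R X` is the notion of a Hilbert `R`-module in which `R`
acts on the left and the inner product is `R`-linear in its second variable. A (right) Hilbert
module `X` over a C⋆-algebra `A`, with the `A`-valued inner product linear in its second variable,
is thus exactly a complete `X` with `CStarModule Aᵐᵒᵖ X`. The right action `x · a` is `op a • x`,
and the `A`-valued inner product is `ip A x y` below.
-/

section InnerProduct

variable (A : Type*) {X : Type*} [NonUnitalCStarAlgebra A] [PartialOrder A]
  [NormedAddCommGroup X] [NormedSpace ℂ X] [SMul Aᵐᵒᵖ X] [CStarModule Aᵐᵒᵖ X]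

/-- The `A`-valued inner product `⟨x, y⟩` of a right Hilbert `A`-module, conjugate linear in `x`
and linear in `y`. -/
noncomputable def ip (x y : X) : A := unop (inner Aᵐᵒᵖ x y)

lemma ip_add_right (x y z : X) : ip A x (y + z) = ip A x y + ip A x z := by
  simp [ip]

lemma ip_smul_right (c : ℂ) (x y : X) : ip A x (c • y) = c • ip A x y := by
  simp [ip]

lemma star_ip (x y : X) : star (ip A x y) = ip A y x := by
  rw [ip, ip, ← unop_star, CStarModule.star_inner]

lemma ip_add_left (x y z : X) : ip A (x + y) z = ip A x z + ip A y z := by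
  rw [← star_ip, ip_add_right, star_add, star_ip, star_ip]

lemma ip_smul_left (c : ℂ) (x y : X) : ip A (c • x) y = star c • ip A x y := by
  rw [← star_ip, ip_smul_right, star_smul, star_ip]

variable {A} in
lemma ip_op_smul_right (a : A) (x y : X) : ip A x (op a • y) = ip A x y * a := by
  simp [ip]

variable {A} in
lemma ip_op_smul_left (a : A) (x y : X) : ip A (op a • x) y = star a * ip A x y := by
  rw [← star_ip, ip_op_smul_right, star_mul, star_ip]

lemma norm_sq_eq_ip (x : X) : ‖x‖ ^ 2 = ‖ip A x x‖ := by
  rw [CStarModule.norm_sq_eq (A := Aᵐᵒᵖ)]; rfl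

lemma ip_zero_right (x : X) : ip A x 0 = 0 := by
  simpa using ip_smul_right A 0 x 0

lemma eq_of_ip {x y : X} (h : ∀ z, ip A z x = ip A z y) : x = y := by
  rw [← sub_eq_zero]
  have h0 : ip A (x - y) (x - y) = 0 := by
    have := ip_add_right A (x - y) (x - y) y
    rw [sub_add_cancel, h] at this
    simpa using this
  have h1 := norm_sq_eq_ip A (x - y)
  rw [h0, norm_zero] at h1
  exact norm_eq_zero.1 (pow_eq_zero_iff two_ne_zero |>.1 h1)

/-- The bounded linear map `a ↦ x · a` given by the right action on `x`. -/
noncomputable def actCLM (x : X) : A →L[ℂ] X :=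
  LinearMap.mkContinuous
    { toFun := fun a => op a • x
      map_add' := fun a b => eq_of_ip A fun z => by
        rw [ip_add_right, ip_op_smul_right, ip_op_smul_right, ip_op_smul_right, mul_add]
      map_smul' := fun c a => eq_of_ip A fun z => by
        simp only [RingHom.id_apply]
        rw [ip_smul_right, ip_op_smul_right, ip_op_smul_right, mul_smul_comm] } ‖x‖ (by
    intro a
    have h : ‖op a • x‖ ^ 2 ≤ (‖x‖ * ‖a‖) ^ 2 := by
      rw [norm_sq_eq_ip A, ip_op_smul_left, ip_op_smul_right]
      calc ‖star a * (ip A x x * a)‖ ≤ ‖star a‖ * (‖ip A x x‖ * ‖a‖) :=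
            (norm_mul_le _ _).trans (by gcongr; exact norm_mul_le _ _)
        _ = (‖x‖ * ‖a‖) ^ 2 := by rw [← norm_sq_eq_ip, norm_star]; ring
    exact (pow_le_pow_iff_left₀ (norm_nonneg _) (by positivity) two_ne_zero).1 h)

lemma actCLM_apply (x : X) (a : A) : actCLM A x a = op a • x := rfl

variable [StarOrderedRing A]

lemma norm_ip_le (x y : X) : ‖ip A x y‖ ≤ ‖x‖ * ‖y‖ :=
  CStarModule.norm_inner_le (A := Aᵐᵒᵖ) X

/-- The bounded linear map `y ↦ ⟨x, y⟩`. -/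
noncomputable def ipCLM (x : X) : X →L[ℂ] A :=
  LinearMap.mkContinuous
    { toFun := fun y => ip A x y
      map_add' := ip_add_right A x
      map_smul' := fun c y => ip_smul_right A c x y } ‖x‖ (norm_ip_le A x)

lemma ipCLM_apply (x y : X) : ipCLM A x y = ip A x y := rfl

end InnerProduct

section Adjointable

variable (A : Type*) {X Y Z : Type*} [NonUnitalCStarAlgebra A] [PartialOrder A]
  [NormedAddCommGroup X] [NormedSpace ℂ X] [SMul Aᵐᵒᵖ X] [CStarModule Aᵐᵒᵖ X]
  [NormedAddCommGroup Y] [NormedSpace ℂ Y] [SMul Aᵐᵒᵖ Y] [CStarModule Aᵐᵒᵖ Y]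
  [NormedAddCommGroup Z] [NormedSpace ℂ Z] [SMul Aᵐᵒᵖ Z] [CStarModule Aᵐᵒᵖ Z]

/-- `S` is an adjoint of `T`. (An adjointable map between Hilbert modules, and its adjoint, are
automatically linear and bounded, so that nothing is lost by taking bounded linear maps.) -/
def IsAdj (T : X →L[ℂ] Y) (S : Y →L[ℂ] X) : Prop := ∀ x y, ip A (T x) y = ip A x (S y)

variable {A} in
lemma IsAdj.symm {T : X →L[ℂ] Y} {S : Y →L[ℂ] X} (h : IsAdj A T S) : IsAdj A S T := fun y x => by
  rw [← star_ip, ← h, star_ip]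

variable {A} in
lemma IsAdj.unique {T : X →L[ℂ] Y} {S S' : Y →L[ℂ] X} (h : IsAdj A T S) (h' : IsAdj A T S') :
    S = S' :=
  ContinuousLinearMap.ext fun y => eq_of_ip A fun x => by rw [← h, ← h']

variable {A} in
lemma IsAdj.comp {T : X →L[ℂ] Y} {T' : Y →L[ℂ] X} {S : Y →L[ℂ] Z} {S' : Z →L[ℂ] Y}
    (hS : IsAdj A S S') (hT : IsAdj A T T') : IsAdj A (S ∘L T) (T' ∘L S') := fun x z => by
  simp only [ContinuousLinearMap.comp_apply]
  rw [hS, hT]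

variable {A} in
lemma IsAdj.add {T T₁ : X →L[ℂ] Y} {S S₁ : Y →L[ℂ] X} (h : IsAdj A T S) (h₁ : IsAdj A T₁ S₁) :
    IsAdj A (T + T₁) (S + S₁) := fun x y => by
  simp only [_root_.add_apply]
  rw [ip_add_left, ip_add_right, h, h₁]

variable {A} in
lemma IsAdj.smul (c : ℂ) {T : X →L[ℂ] Y} {S : Y →L[ℂ] X} (h : IsAdj A T S) :
    IsAdj A (c • T) (star c • S) := fun x y => by
  simp only [_root_.smul_apply]
  rw [ip_smul_left, ip_smul_right, h]

lemma isAdj_one : IsAdj A (1 : X →L[ℂ] X) 1 := fun _ _ => rfl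

variable (X Y) in
/-- The Banach space `𝓛(X, Y)` of adjointable operators, with the operator norm. -/
def Adj : Submodule ℂ (X →L[ℂ] Y) where
  carrier := {T | ∃ S, IsAdj A T S}
  add_mem' := fun ⟨S, h⟩ ⟨S', h'⟩ => ⟨S + S', h.add h'⟩
  zero_mem' := ⟨0, fun x y => by
    simpa [ip_zero_right] using ip_smul_left A 0 (0 : Y) y⟩
  smul_mem' := fun c _ ⟨S, h⟩ => ⟨star c • S, h.smul c⟩

variable (X) in
/-- The algebra `𝓛(X)` of adjointable operators on `X`, with composition as product and with the
operator norm. It has the same elements as `𝓛(X, X)`. -/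
def AdjEnd : Subalgebra ℂ (X →L[ℂ] X) where
  carrier := {T | ∃ S, IsAdj A T S}
  add_mem' := fun ⟨S, h⟩ ⟨S', h'⟩ => ⟨S + S', h.add h'⟩
  mul_mem' := fun ⟨S, h⟩ ⟨S', h'⟩ => ⟨S' ∘L S, h.comp h'⟩
  algebraMap_mem' := fun c => by
    rw [Algebra.algebraMap_eq_smul_one]
    exact ⟨star c • 1, (isAdj_one A).smul c⟩

variable {A}

/-- The adjoint `T⋆ : Y → X` of an adjointable operator `T : X → Y`. -/
noncomputable def adjoint (T : Adj A X Y) : Adj A Y X :=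
  ⟨T.2.choose, T, T.2.choose_spec.symm⟩

lemma isAdj_adjoint (T : Adj A X Y) : IsAdj A (T : X →L[ℂ] Y) (adjoint T : Y →L[ℂ] X) :=
  T.2.choose_spec

/-- The composition `S T` of adjointable operators `T : X → Y` and `S : Y → X`, as an element of
the algebra `𝓛(X)`. -/
def compEnd (S : Adj A Y X) (T : Adj A X Y) : AdjEnd A X :=
  ⟨(S : Y →L[ℂ] X) ∘L (T : X →L[ℂ] Y), (adjoint T : Y →L[ℂ] X) ∘L (adjoint S : X →L[ℂ] Y),
    (isAdj_adjoint S).comp (isAdj_adjoint T)⟩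

end Adjointable

section AdjointableAlgebra

variable {A X : Type*} [NonUnitalCStarAlgebra A] [PartialOrder A]
  [NormedAddCommGroup X] [NormedSpace ℂ X] [SMul Aᵐᵒᵖ X] [CStarModule Aᵐᵒᵖ X]

noncomputable instance : NormedRing (AdjEnd A X) := Subalgebra.normedRing _

noncomputable instance : NormedAlgebra ℂ (AdjEnd A X) :=
  Subalgebra.toNormedAlgebra _

/-- The involution of `𝓛(X)` is the adjoint. -/
noncomputable instance : Star (AdjEnd A X) where
  star T := ⟨T.2.choose, T, T.2.choose_spec.symm⟩

lemma isAdj_star (T : AdjEnd A X) :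
    IsAdj A (T : X →L[ℂ] X) ((star T : AdjEnd A X) : X →L[ℂ] X) :=
  T.2.choose_spec

lemma star_eq_of_isAdj {T S : AdjEnd A X} (h : IsAdj A (T : X →L[ℂ] X) (S : X →L[ℂ] X)) :
    star T = S :=
  Subtype.ext ((isAdj_star T).unique h)

noncomputable instance : StarRing (AdjEnd A X) where
  star_involutive T := star_eq_of_isAdj (isAdj_star T).symm
  star_mul S T := star_eq_of_isAdj ((isAdj_star S).comp (isAdj_star T))
  star_add S T := star_eq_of_isAdj ((isAdj_star S).add (isAdj_star T))

instance : StarModule ℂ (AdjEnd A X) where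
  star_smul c T := star_eq_of_isAdj ((isAdj_star T).smul c)

variable [StarOrderedRing A]

instance : CStarRing (AdjEnd A X) where
  norm_mul_self_le T := by
    have h : ‖(T : X →L[ℂ] X)‖ ≤ √‖star T * T‖ := by
      refine ContinuousLinearMap.opNorm_le_bound _ (Real.sqrt_nonneg _) fun x => ?_
      have h1 : ‖(T : X →L[ℂ] X) x‖ ^ 2 ≤ ‖star T * T‖ * (‖x‖ * ‖x‖) := by
        rw [norm_sq_eq_ip A, isAdj_star T]
        calc _ ≤ ‖x‖ * ‖((star T * T : AdjEnd A X) : X →L[ℂ] X) x‖ := norm_ip_le A _ _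
          _ ≤ ‖x‖ * (‖star T * T‖ * ‖x‖) := by
            gcongr
            exact ContinuousLinearMap.le_opNorm _ _
          _ = _ := by ring
      refine (pow_le_pow_iff_left₀ (norm_nonneg _) (by positivity) two_ne_zero).1 ?_
      calc _ ≤ _ := h1
        _ = √‖star T * T‖ ^ 2 * (‖x‖ * ‖x‖) := by rw [Real.sq_sqrt (norm_nonneg _)]
        _ = _ := by ring
    calc ‖T‖ * ‖T‖ ≤ √‖star T * T‖ * √‖star T * T‖ := by gcongr <;> exact h
      _ = ‖star T * T‖ := Real.mul_self_sqrt (norm_nonneg _)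

lemma isClosed_adjEnd [CompleteSpace X] : IsClosed (AdjEnd A X : Set (X →L[ℂ] X)) := by
  rw [← isSeqClosed_iff_isClosed]
  intro T L hT hL
  let U : ℕ → AdjEnd A X := fun n => ⟨T n, hT n⟩
  have hC : CauchySeq U := by
    have := hL.cauchySeq
    rw [Metric.cauchySeq_iff] at this ⊢
    exact this
  have hC' : CauchySeq fun n => ((star (U n) : AdjEnd A X) : X →L[ℂ] X) := by
    rw [Metric.cauchySeq_iff] at hC ⊢
    intro ε hε
    obtain ⟨N, hN⟩ := hC ε hε
    refine ⟨N, fun m hm n hn => ?_⟩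
    have h1 := hN m hm n hn
    rw [dist_eq_norm, ← norm_star, star_sub] at h1
    rw [dist_eq_norm]
    exact h1
  obtain ⟨S, hS⟩ := cauchySeq_tendsto_of_complete hC'
  refine ⟨S, fun x y => ?_⟩
  have hl : Filter.Tendsto (fun n => star (ip A y ((U n : X →L[ℂ] X) x))) Filter.atTop
      (nhds (star (ip A y (L x)))) :=
    ((ipCLM A y).continuous.tendsto _ |>.comp
      ((ContinuousLinearMap.apply ℂ X x).continuous.tendsto _ |>.comp hL)).star
  have hr : Filter.Tendsto (fun n => ip A x (((star (U n) : AdjEnd A X) : X →L[ℂ] X) y))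
      Filter.atTop (nhds (ip A x (S y))) :=
    (ipCLM A x).continuous.tendsto _ |>.comp
      ((ContinuousLinearMap.apply ℂ X y).continuous.tendsto _ |>.comp hS)
  rw [star_ip] at hl
  refine tendsto_nhds_unique (hl.congr fun n => ?_) hr
  rw [star_ip, isAdj_star (U n)]

/-- `𝓛(X)` is a C⋆-algebra. -/
noncomputable instance [CompleteSpace X] : CStarAlgebra (AdjEnd A X) where
  toCompleteSpace := isClosed_adjEnd.completeSpace_coe

end AdjointableAlgebra

section Compact

variable (A : Type*) {X : Type*} [NonUnitalCStarAlgebra A] [PartialOrder A] [StarOrderedRing A]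
  [NormedAddCommGroup X] [NormedSpace ℂ X] [SMul Aᵐᵒᵖ X] [CStarModule Aᵐᵒᵖ X]

/-- The rank one operator `θ_{x,y} : z ↦ x · ⟨y, z⟩`. -/
noncomputable def theta (x y : X) : AdjEnd A X :=
  ⟨actCLM A x ∘L ipCLM A y, actCLM A y ∘L ipCLM A x, fun z w => by
    simp only [ContinuousLinearMap.comp_apply, actCLM_apply, ipCLM_apply]
    rw [ip_op_smul_left, ip_op_smul_right, star_ip]⟩

lemma theta_apply (x y z : X) : (theta A x y : X →L[ℂ] X) z = op (ip A y z) • x := rfl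

lemma star_theta (x y : X) : star (theta A x y) = theta A y x :=
  star_eq_of_isAdj fun z w => by
    rw [theta_apply, theta_apply, ip_op_smul_left, ip_op_smul_right, star_ip]

lemma mul_theta (T : AdjEnd A X) (x y : X) : T * theta A x y = theta A ((T : X →L[ℂ] X) x) y := by
  refine Subtype.ext (ContinuousLinearMap.ext fun z => eq_of_ip A fun w => ?_)
  change ip A w ((T : X →L[ℂ] X) (op (ip A y z) • x)) = ip A w (op (ip A y z) • (T : X →L[ℂ] X) x)
  rw [← (isAdj_star T).symm, ip_op_smul_right, ip_op_smul_right, ← (isAdj_star T).symm]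

variable (X) in
/-- The closed linear span of the operators `θ_{x,y}` in `𝓛(X)`. -/
noncomputable def compactSpan : Submodule ℂ (AdjEnd A X) :=
  (Submodule.span ℂ {T | ∃ x y : X, T = theta A x y}).topologicalClosure

variable {A}

lemma theta_mem_compactSpan (x y : X) : theta A x y ∈ compactSpan A X :=
  Submodule.le_topologicalClosure _ (Submodule.subset_span ⟨x, y, rfl⟩)

lemma star_mem_compactSpan {K : AdjEnd A X} (hK : K ∈ compactSpan A X) :
    star K ∈ compactSpan A X := by
  refine map_mem_closure continuous_star hK fun k hk => ?_
  induction hk using Submodule.span_induction with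
  | mem k hk =>
    obtain ⟨x, y, rfl⟩ := hk
    exact Submodule.subset_span ⟨y, x, star_theta A x y⟩
  | zero => simp
  | add S T _ _ hS hT => rw [star_add]; exact add_mem hS hT
  | smul c T _ hT => rw [star_smul]; exact Submodule.smul_mem _ _ hT

lemma mul_mem_compactSpan (T : AdjEnd A X) {K : AdjEnd A X} (hK : K ∈ compactSpan A X) :
    T * K ∈ compactSpan A X := by
  refine map_mem_closure (continuous_const_mul T) hK fun k hk => ?_
  induction hk using Submodule.span_induction with
  | mem k hk =>
    obtain ⟨x, y, rfl⟩ := hk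
    exact Submodule.subset_span ⟨_, y, mul_theta A T x y⟩
  | zero => simp
  | add S T' _ _ hS hT => rw [mul_add]; exact add_mem hS hT
  | smul c T' _ hT => rw [mul_smul_comm]; exact Submodule.smul_mem _ _ hT

lemma mem_compactSpan_mul {K : AdjEnd A X} (hK : K ∈ compactSpan A X) (T : AdjEnd A X) :
    K * T ∈ compactSpan A X := by
  have := star_mem_compactSpan (mul_mem_compactSpan (star T) (star_mem_compactSpan hK))
  rwa [star_mul, star_star, star_star] at this

variable (A X) in
/-- The compact operators on `X`: the closed linear span of the operators `θ_{x,y}`, as a closed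
⋆-subalgebra (in fact a two-sided ideal) of `𝓛(X)`. -/
noncomputable def compactSubalgebra : NonUnitalStarSubalgebra ℂ (AdjEnd A X) where
  __ := compactSpan A X
  mul_mem' := fun _ hT => mul_mem_compactSpan _ hT
  star_mem' := star_mem_compactSpan

instance : IsClosed (compactSubalgebra A X : Set (AdjEnd A X)) :=
  Submodule.isClosed_topologicalClosure _

variable (A X) in
/-- The C⋆-algebra `𝓚(X)` of compact operators on `X`, with the operations and the norm of
`𝓛(X)`. -/
def Compacts : Type _ := compactSubalgebra A X

variable [CompleteSpace X]

noncomputable instance : NonUnitalCStarAlgebra (Compacts A X) :=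
  NonUnitalStarSubalgebra.nonUnitalCStarAlgebra (compactSubalgebra A X)

/-- The inclusion `𝓚(X) → 𝓛(X)`. -/
noncomputable def Compacts.incl : Compacts A X →⋆ₙₐ[ℂ] AdjEnd A X :=
  NonUnitalStarSubalgebraClass.subtype (compactSubalgebra A X)

/-- An element of `𝓛(X)` in the closed linear span of the `θ_{x,y}`, as an element of `𝓚(X)`. -/
def Compacts.mk (T : AdjEnd A X) (hT : T ∈ compactSpan A X) : Compacts A X := ⟨T, hT⟩

lemma Compacts.incl_mk (T : AdjEnd A X) (hT : T ∈ compactSpan A X) :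
    Compacts.incl (Compacts.mk T hT) = T := rfl

lemma Compacts.incl_mem (k : Compacts A X) : Compacts.incl k ∈ compactSpan A X := k.2

lemma Compacts.incl_injective : Function.Injective (Compacts.incl (A := A) (X := X)) :=
  Subtype.val_injective

lemma Compacts.norm_incl (k : Compacts A X) : ‖Compacts.incl k‖ = ‖k‖ := rfl

variable (A) in
/-- The rank one operator `θ_{x,y}` as an element of `𝓚(X)`. -/
noncomputable def thetaK (x y : X) : Compacts A X :=
  Compacts.mk (theta A x y) (theta_mem_compactSpan x y)

/-- The canonical map `𝓛(X) → M(𝓚(X))` (an isomorphism): the adjointable operator `T` is sent to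
the multiplier `(k ↦ T k, k ↦ k T)` of `𝓚(X)`. -/
noncomputable def adjToMult (T : AdjEnd A X) : 𝓜(ℂ, Compacts A X) where
  fst := LinearMap.mkContinuous
    { toFun := fun k => Compacts.mk (T * Compacts.incl k) (mul_mem_compactSpan T k.incl_mem)
      map_add' := fun k l => Compacts.incl_injective <| by
        simp only [map_add, Compacts.incl_mk, mul_add]
      map_smul' := fun c k => Compacts.incl_injective <| by
        simp only [map_smul, Compacts.incl_mk, mul_smul_comm, RingHom.id_apply] } ‖T‖
    fun k => norm_mul_le T (Compacts.incl k)
  snd := LinearMap.mkContinuous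
    { toFun := fun k => Compacts.mk (Compacts.incl k * T) (mem_compactSpan_mul k.incl_mem T)
      map_add' := fun k l => Compacts.incl_injective <| by
        simp only [map_add, Compacts.incl_mk, add_mul]
      map_smul' := fun c k => Compacts.incl_injective <| by
        simp only [map_smul, Compacts.incl_mk, smul_mul_assoc, RingHom.id_apply] } ‖T‖
    fun k => (norm_mul_le (Compacts.incl k) T).trans_eq (mul_comm _ _)
  central k l := Compacts.incl_injective (mul_assoc (Compacts.incl k) T (Compacts.incl l))

end Compact

section Multiplier

variable {B : Type*} [NonUnitalCStarAlgebra B] [PartialOrder B] [StarOrderedRing B]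

/-- A C⋆-algebra `B` as a right Hilbert `B`-module: `b · c = b c` and `⟨b, c⟩ = b⋆ c`. -/
noncomputable instance selfHilbertModule : CStarModule Bᵐᵒᵖ B where
  inner b c := op (star b * c)
  inner_add_right := by simp [mul_add]
  inner_self_nonneg {x} := by
    rw [← unop_le_unop]
    exact star_mul_self_nonneg x
  inner_self {x} := by rw [op_eq_zero_iff, CStarRing.star_mul_self_eq_zero_iff]
  inner_op_smul_right {a x y} := by
    rw [← unop_inj]
    simp [MulOpposite.smul_eq_mul_unop, mul_assoc]
  inner_smul_right_complex {c x y} := by rw [mul_smul_comm, op_smul]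
  star_inner b c := by rw [← op_star]; simp
  norm_eq_sqrt_norm_inner_self b := by
    rw [norm_op, CStarRing.norm_star_mul_self, Real.sqrt_mul_self (norm_nonneg _)]

lemma ip_self_def (b c : B) : ip B b c = star b * c := rfl

/-- The canonical map `𝓛(B) → M(B)` (an isomorphism) for the Hilbert `B`-module `B`: an adjointable
operator `T` is sent to the multiplier with left part `b ↦ T b`. Its right part is then
`b ↦ (T⋆ b⋆)⋆`. -/
noncomputable def selfToMult (T : AdjEnd B B) : 𝓜(ℂ, B) where
  fst := T
  snd := LinearMap.mkContinuous
    { toFun := fun b => star (((star T : AdjEnd B B) : B →L[ℂ] B) (star b))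
      map_add' := by simp
      map_smul' := by simp } ‖((star T : AdjEnd B B) : B →L[ℂ] B)‖ fun b => by
        simpa using ((star T : AdjEnd B B) : B →L[ℂ] B).le_opNorm (star b)
  central b c := by
    have h := (isAdj_star T).symm (star b) c
    rw [ip_self_def, ip_self_def, star_star] at h
    exact h

variable {Y : Type*} [NormedAddCommGroup Y] [NormedSpace ℂ Y] [SMul Bᵐᵒᵖ Y] [CStarModule Bᵐᵒᵖ Y]

variable (B Y) in
/-- The multiplier module `M(Y) = 𝓛(B, Y)` of a Hilbert `B`-module `Y`. -/
noncomputable abbrev MultMod : Submodule ℂ (B →L[ℂ] Y) := Adj B B Y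

/-- The `M(B)`-valued inner product `⟨m, n⟩ = m⋆ n` of `M(Y)`. -/
noncomputable def multIp (m n : MultMod B Y) : 𝓜(ℂ, B) := selfToMult (compEnd (adjoint m) n)

/-- The right action `m · μ` of a multiplier `μ ∈ M(B)` on `m ∈ M(Y)`, given by composition. -/
noncomputable def multAct (m : MultMod B Y) (μ : 𝓜(ℂ, B)) : MultMod B Y :=
  ⟨(m : B →L[ℂ] Y) ∘L μ.fst, (star μ).fst ∘L (adjoint m : Y →L[ℂ] B), (isAdj_adjoint m).comp fun b c => by
    rw [ip_self_def, ip_self_def, DoubleCentralizer.star_fst, ← star_inj, star_mul, star_mul,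
      star_star, star_star, star_star]
    exact (μ.central (star c) b).symm⟩

/-- The embedding `Y → M(Y)`, `y ↦ T_y`, where `T_y b = y · b`. -/
noncomputable def multOf (y : Y) : MultMod B Y :=
  ⟨actCLM B y, ipCLM B y, fun b z => ip_op_smul_left b y z⟩

end Multiplier

section Correspondence

variable (A B X Y : Type*)
  [NonUnitalCStarAlgebra A] [PartialOrder A] [StarOrderedRing A]
  [NonUnitalCStarAlgebra B] [PartialOrder B] [StarOrderedRing B]
  [NormedAddCommGroup X] [NormedSpace ℂ X] [SMul Aᵐᵒᵖ X] [CStarModule Aᵐᵒᵖ X]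
  [NormedAddCommGroup Y] [NormedSpace ℂ Y] [SMul Bᵐᵒᵖ Y] [CStarModule Bᵐᵒᵖ Y]

/-- A correspondence homomorphism `(ψ, ρ) : (X, A) → (M(Y), M(B))` of (right) Hilbert modules. -/
structure CorrHom where
  /-- the linear map `ψ : X → M(Y)` -/
  ψ : X →ₗ[ℂ] MultMod B Y
  /-- the ⋆-homomorphism `ρ : A → M(B)` -/
  ρ : A →⋆ₙₐ[ℂ] 𝓜(ℂ, B)
  map_act : ∀ (ξ : X) (a : A), ψ (op a • ξ) = multAct (ψ ξ) (ρ a)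
  map_ip : ∀ ξ η : X, ρ (ip A ξ η) = multIp (ψ ξ) (ψ η)

end Correspondence

end HilbertMod

/-! The homomorphism should send `k ∈ 𝓚(X)` to the operator `S` on `Y` with `S (ψ(ξ) b) = ψ(k ξ) b`;
for `k = θ_{ξ,η}` the operator `ψ(ξ) ψ(η)⋆` does this, since `ψ(ξ · ⟨η, ζ⟩) = ψ(ξ) ψ(η)⋆ ψ(ζ)`. This
fixes `S` only on the closed span `R` of the vectors `ψ(ξ) b`, and `R` need not be complemented in
`Y`. So one also asks that `S` maps `Y` into `R`, and that `S⋆` satisfies the same two conditions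
relative to `k⋆`.

Such pairs `(T, S)` form a C⋆-algebra in `𝓛(X) × 𝓛(Y)` (`intertwiners`). Its first projection is
injective: if `T = 0`, then `S` kills `R`, which contains the image of `S⋆`, so `S S⋆ = 0`. An
injective ⋆-homomorphism of C⋆-algebras is isometric, so the image of the projection is closed. It
contains every `θ_{ξ,η}`, hence all of `𝓚(X)` (`exists_mem_intertwiners`). Inverting the projection
over `𝓚(X)` and taking the second component gives `compactsHom`; no norm estimate for sums of rank
one operators is needed. Uniqueness and the case `ψ(X) ⊆ Y` follow from density of the span of the
`θ_{ξ,η}` and automatic continuity. -/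

namespace HilbertMod

/-! ### Density of rank one operators, and adjointable operators as multipliers of the compacts -/

section Compact

variable {A X : Type*} [NonUnitalCStarAlgebra A] [PartialOrder A] [StarOrderedRing A]
  [NormedAddCommGroup X] [NormedSpace ℂ X] [SMul Aᵐᵒᵖ X] [CStarModule Aᵐᵒᵖ X]

/-- A closed subspace of `𝓛(X)` containing the rank one operators contains `𝓚(X)`. -/
lemma compactSpan_le {V : Submodule ℂ (AdjEnd A X)} (hV : IsClosed (V : Set (AdjEnd A X)))
    (h : ∀ x y : X, theta A x y ∈ V) : compactSpan A X ≤ V := by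
  refine Submodule.topologicalClosure_minimal _ (Submodule.span_le.2 ?_) hV
  rintro _ ⟨x, y, rfl⟩
  exact h x y

variable [CompleteSpace X]

/-- A closed subspace of `𝓚(X)` containing the rank one operators is everything. -/
lemma mem_of_thetaK_mem {V : Submodule ℂ (Compacts A X)} (hV : IsClosed (V : Set (Compacts A X)))
    (h : ∀ x y : X, thetaK A x y ∈ V) (k : Compacts A X) : k ∈ V := by
  -- An isometry from a complete space is a closed embedding, so the image of `V` is closed in
  -- `𝓛(X)`.
  have hi : Isometry (Compacts.incl (A := A) (X := X)) :=
    NonUnitalStarAlgHom.isometry _ Compacts.incl_injective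
  have hle : compactSpan A X ≤ V.map (Compacts.incl (A := A) (X := X) : Compacts A X →ₗ[ℂ] _) := by
    refine compactSpan_le ?_ fun x y => ⟨_, h x y, rfl⟩
    exact hi.isClosedEmbedding.isClosedMap _ hV
  obtain ⟨l, hl, hlk⟩ := hle k.incl_mem
  rwa [← Compacts.incl_injective hlk]

lemma incl_adjToMult_fst (T : AdjEnd A X) (k : Compacts A X) :
    Compacts.incl ((adjToMult T).fst k) = T * Compacts.incl k := rfl

lemma incl_adjToMult_snd (T : AdjEnd A X) (k : Compacts A X) :
    Compacts.incl ((adjToMult T).snd k) = Compacts.incl k * T := rfl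

lemma adjToMult_eq_of_incl {T : AdjEnd A X} {μ : 𝓜(ℂ, Compacts A X)}
    (hl : ∀ k, T * Compacts.incl k = Compacts.incl (μ.fst k))
    (hr : ∀ k, Compacts.incl k * T = Compacts.incl (μ.snd k)) : adjToMult T = μ := by
  refine DoubleCentralizer.ext _ _ _ _ (Prod.ext ?_ ?_)
  · exact ContinuousLinearMap.ext fun k => Compacts.incl_injective (hl k)
  · exact ContinuousLinearMap.ext fun k => Compacts.incl_injective (hr k)

variable (A X) in
/-- The canonical map `𝓛(X) → M(𝓚(X))` as a ⋆-homomorphism. -/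
noncomputable def adjToMultHom : AdjEnd A X →⋆ₙₐ[ℂ] 𝓜(ℂ, Compacts A X) where
  toFun := adjToMult
  map_smul' c T := by
    refine adjToMult_eq_of_incl (fun k => ?_) fun k => ?_
    · rw [MonoidHom.id_apply, DoubleCentralizer.smul_fst, _root_.smul_apply, map_smul,
        incl_adjToMult_fst, smul_mul_assoc]
    · rw [MonoidHom.id_apply, DoubleCentralizer.smul_snd, _root_.smul_apply, map_smul,
        incl_adjToMult_snd, mul_smul_comm]
  map_zero' := by
    refine adjToMult_eq_of_incl (fun k => ?_) fun k => ?_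
    · rw [DoubleCentralizer.zero_fst, _root_.zero_apply, map_zero, zero_mul]
    · rw [DoubleCentralizer.zero_snd, _root_.zero_apply, map_zero, mul_zero]
  map_add' S T := by
    refine adjToMult_eq_of_incl (fun k => ?_) fun k => ?_
    · rw [DoubleCentralizer.add_fst, _root_.add_apply, map_add, incl_adjToMult_fst,
        incl_adjToMult_fst, add_mul]
    · rw [DoubleCentralizer.add_snd, _root_.add_apply, map_add, incl_adjToMult_snd,
        incl_adjToMult_snd, mul_add]
  map_mul' S T := by
    refine adjToMult_eq_of_incl (fun k => ?_) fun k => ?_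
    · rw [DoubleCentralizer.mul_fst, mul_apply_eq_comp, incl_adjToMult_fst,
        incl_adjToMult_fst, mul_assoc]
    · rw [DoubleCentralizer.mul_snd, mul_apply_eq_comp, incl_adjToMult_snd,
        incl_adjToMult_snd, mul_assoc]
  map_star' T := by
    refine adjToMult_eq_of_incl (fun k => ?_) fun k => ?_
    -- The involution on multipliers exchanges the left and right parts, so this is `(k⋆ T)⋆ = T⋆
    -- k`.
    · rw [DoubleCentralizer.star_fst, map_star, incl_adjToMult_snd, map_star, star_mul, star_star]
    · rw [DoubleCentralizer.star_snd, map_star, incl_adjToMult_fst, map_star, star_mul, star_star]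

lemma adjToMultHom_apply (T : AdjEnd A X) : adjToMultHom A X T = adjToMult T := rfl

/-- This identifies the two ways of viewing a compact operator as a multiplier, so that membership
in `𝓚(Y)` can be checked in `𝓛(Y)`. -/
lemma adjToMult_incl (k : Compacts A X) :
    adjToMult (Compacts.incl k) = DoubleCentralizer.coe ℂ k :=
  adjToMult_eq_of_incl (fun l => (map_mul Compacts.incl k l).symm)
    fun l => (map_mul Compacts.incl l k).symm

end Compact

/-! ### Products `m n⋆` of multiplier module elements -/

section Adjointable

variable {B Y : Type*} [NonUnitalCStarAlgebra B] [PartialOrder B] [StarOrderedRing B]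
  [NormedAddCommGroup Y] [NormedSpace ℂ Y] [SMul Bᵐᵒᵖ Y] [CStarModule Bᵐᵒᵖ Y]

lemma star_compEnd_adjoint (m n : MultMod B Y) :
    star (compEnd m (adjoint n)) = compEnd n (adjoint m) :=
  star_eq_of_isAdj ((isAdj_adjoint m).comp (isAdj_adjoint n).symm)

/-- The adjoint of `T_z` is `w ↦ ⟨z, w⟩`. As `adjoint` is obtained by choice, this comes from
uniqueness of adjoints. -/
lemma compEnd_multOf (y z : Y) :
    compEnd (multOf y : MultMod B Y) (adjoint (multOf z : MultMod B Y)) = theta B y z := by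
  have h : (adjoint (multOf z : MultMod B Y) : Y →L[ℂ] B) = ipCLM B z :=
    (isAdj_adjoint (multOf z : MultMod B Y)).unique fun b w => ip_op_smul_left b z w
  refine Subtype.ext ?_
  change actCLM B y ∘L (adjoint (multOf z : MultMod B Y) : Y →L[ℂ] B) = actCLM B y ∘L ipCLM B z
  rw [h]

end Adjointable

/-! ### Intertwining pairs of operators on `X` and `Y` -/

namespace CorrHom

variable {A B X Y : Type*}
  [NonUnitalCStarAlgebra A] [PartialOrder A] [StarOrderedRing A]
  [NonUnitalCStarAlgebra B] [PartialOrder B] [StarOrderedRing B]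
  [NormedAddCommGroup X] [NormedSpace ℂ X] [SMul Aᵐᵒᵖ X] [CStarModule Aᵐᵒᵖ X]
  [NormedAddCommGroup Y] [NormedSpace ℂ Y] [SMul Bᵐᵒᵖ Y] [CStarModule Bᵐᵒᵖ Y]
  (f : CorrHom A B X Y)

/-- The vector `ψ(ξ) b` of `Y`. -/
noncomputable def vec (ξ : X) (b : B) : Y := (f.ψ ξ : B →L[ℂ] Y) b

lemma vec_def (ξ : X) (b : B) : f.vec ξ b = (f.ψ ξ : B →L[ℂ] Y) b := rfl

lemma vec_add (ξ η : X) (b : B) : f.vec (ξ + η) b = f.vec ξ b + f.vec η b := by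
  simp [vec_def]

lemma vec_smul (c : ℂ) (ξ : X) (b : B) : f.vec (c • ξ) b = c • f.vec ξ b := by
  simp [vec_def]

lemma ip_vec (ξ η : X) (b c : B) :
    ip B (f.vec ξ b) (f.vec η c) = star b * (f.ρ (ip A ξ η)).fst c := by
  rw [f.map_ip, vec_def, isAdj_adjoint]
  rfl

/-- Both axioms of a correspondence homomorphism combine to `ψ(ξ · ⟨η, ζ⟩) = ψ(ξ) ρ(⟨η, ζ⟩) = ψ(ξ)
ψ(η)⋆ ψ(ζ)`. -/
lemma vec_op_smul (ξ η ζ : X) (b : B) :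
    f.vec (op (ip A η ζ) • ξ) b
      = ((compEnd (f.ψ ξ) (adjoint (f.ψ η)) : AdjEnd B Y) : Y →L[ℂ] Y) (f.vec ζ b) := by
  rw [vec_def, f.map_act, f.map_ip]
  rfl

/-- Continuity of `ψ` is not assumed; it comes from `‖ψ(ξ) b‖² = ‖b⋆ ρ(⟨ξ, ξ⟩) b‖` and contractivity
of `ρ`. -/
lemma norm_vec_le (ξ : X) (b : B) : ‖f.vec ξ b‖ ≤ ‖b‖ * ‖ξ‖ := by
  refine (pow_le_pow_iff_left₀ (norm_nonneg _) (by positivity) two_ne_zero).1 ?_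
  rw [norm_sq_eq_ip B, ip_vec]
  calc _ ≤ ‖star b‖ * (‖(f.ρ (ip A ξ ξ)).fst‖ * ‖b‖) :=
        (norm_mul_le _ _).trans (by gcongr; exact ContinuousLinearMap.le_opNorm _ _)
    _ ≤ ‖star b‖ * (‖ip A ξ ξ‖ * ‖b‖) := by
        gcongr
        rw [DoubleCentralizer.norm_fst]
        exact NonUnitalStarAlgHom.norm_apply_le f.ρ _
    _ = _ := by rw [norm_star, ← norm_sq_eq_ip]; ring

lemma continuous_vec (b : B) : Continuous fun ξ => f.vec ξ b :=
  (LinearMap.mkContinuous (σ := RingHom.id ℂ)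
    { toFun := fun ξ => f.vec ξ b
      map_add' := fun ξ η => f.vec_add ξ η b
      map_smul' := fun c ξ => f.vec_smul c ξ b } ‖b‖ fun ξ => f.norm_vec_le ξ b).continuous

/-- The closed linear span of the vectors `ψ(ξ) b`. -/
def range : Submodule ℂ Y :=
  (Submodule.span ℂ {y | ∃ ξ b, y = f.vec ξ b}).topologicalClosure

lemma isClosed_range : IsClosed (f.range : Set Y) := Submodule.isClosed_topologicalClosure _

lemma vec_mem_range (ξ : X) (b : B) : f.vec ξ b ∈ f.range :=
  Submodule.le_topologicalClosure _ (Submodule.subset_span ⟨ξ, b, rfl⟩)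

lemma eq_zero_of_mem_range {S : Y →L[ℂ] Y} (h : ∀ ξ b, S (f.vec ξ b) = 0) {y : Y}
    (hy : y ∈ f.range) : S y = 0 := by
  suffices f.range ≤ S.ker from this hy
  refine Submodule.topologicalClosure_minimal _ (Submodule.span_le.2 ?_) S.isClosed_ker
  rintro _ ⟨ξ, b, rfl⟩
  exact h ξ b

/-- `S` restricts to the operator induced by `T` on the closed span of the `ψ(ξ) b`, and maps
everything into this closed span. -/
def Intertwines (T : AdjEnd A X) (S : AdjEnd B Y) : Prop :=
  (∀ ξ b, (S : Y →L[ℂ] Y) (f.vec ξ b) = f.vec ((T : X →L[ℂ] X) ξ) b) ∧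
    ∀ y, (S : Y →L[ℂ] Y) y ∈ f.range

variable {f} in
lemma Intertwines.mul {T T' : AdjEnd A X} {S S' : AdjEnd B Y} (h : f.Intertwines T S)
    (h' : f.Intertwines T' S') : f.Intertwines (T * T') (S * S') :=
  ⟨fun ξ b => (congrArg (S : Y →L[ℂ] Y) (h'.1 ξ b)).trans (h.1 _ b), fun _ => h.2 _⟩

variable {f} in
lemma Intertwines.add {T T' : AdjEnd A X} {S S' : AdjEnd B Y} (h : f.Intertwines T S)
    (h' : f.Intertwines T' S') : f.Intertwines (T + T') (S + S') :=
  ⟨fun ξ b => (congrArg₂ (· + ·) (h.1 ξ b) (h'.1 ξ b)).trans (f.vec_add _ _ b).symm,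
    fun y => add_mem (h.2 y) (h'.2 y)⟩

variable {f} in
lemma Intertwines.smul (c : ℂ) {T : AdjEnd A X} {S : AdjEnd B Y} (h : f.Intertwines T S) :
    f.Intertwines (c • T) (c • S) :=
  ⟨fun ξ b => (congrArg (c • ·) (h.1 ξ b)).trans (f.vec_smul c _ b).symm,
    fun y => Submodule.smul_mem _ c (h.2 y)⟩

lemma intertwines_zero : f.Intertwines 0 0 :=
  ⟨fun ξ b => by simpa using (f.vec_smul 0 0 b).symm, fun _ => zero_mem _⟩

lemma intertwines_theta (ξ η : X) :
    f.Intertwines (theta A ξ η) (compEnd (f.ψ ξ) (adjoint (f.ψ η))) :=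
  ⟨fun ζ b => (f.vec_op_smul ξ η ζ b).symm, fun _ => f.vec_mem_range ξ _⟩

/-- Each condition is pointwise in `ξ`, `b` or `y`, and closed because evaluation and `ξ ↦ ψ(ξ) b`
are continuous and `f.range` is closed. -/
lemma isClosed_intertwines :
    IsClosed {p : AdjEnd A X × AdjEnd B Y | f.Intertwines p.1 p.2} := by
  have hX (ξ : X) : Continuous fun p : AdjEnd A X × AdjEnd B Y => (p.1 : X →L[ℂ] X) ξ :=
    (ContinuousLinearMap.apply ℂ X ξ).continuous.comp (continuous_subtype_val.comp continuous_fst)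
  have hY (y : Y) : Continuous fun p : AdjEnd A X × AdjEnd B Y => (p.2 : Y →L[ℂ] Y) y :=
    (ContinuousLinearMap.apply ℂ Y y).continuous.comp (continuous_subtype_val.comp continuous_snd)
  simp only [Intertwines, Set.ofPred_and, Set.ofPred_forall]
  exact (isClosed_iInter fun ξ => isClosed_iInter fun b =>
    isClosed_eq (hY _) ((f.continuous_vec b).comp (hX ξ))).inter
    (isClosed_iInter fun y => f.isClosed_range.preimage (hY y))

/-- The pairs `(T, S)` such that both `(T, S)` and `(T⋆, S⋆)` intertwine, as a closed
⋆-subalgebra of `𝓛(X) × 𝓛(Y)`. -/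
noncomputable def intertwiners : NonUnitalStarSubalgebra ℂ (AdjEnd A X × AdjEnd B Y) where
  carrier := {p | f.Intertwines p.1 p.2 ∧ f.Intertwines (star p.1) (star p.2)}
  add_mem' {p q} hp hq := ⟨hp.1.add hq.1, by
    rw [Prod.fst_add, Prod.snd_add, star_add, star_add]; exact hp.2.add hq.2⟩
  zero_mem' := ⟨f.intertwines_zero, by
    rw [Prod.fst_zero, Prod.snd_zero, star_zero, star_zero]; exact f.intertwines_zero⟩
  mul_mem' {p q} hp hq := ⟨hp.1.mul hq.1, by
    rw [Prod.fst_mul, Prod.snd_mul, star_mul, star_mul]; exact hq.2.mul hp.2⟩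
  smul_mem' c p hp := ⟨hp.1.smul c, by
    rw [Prod.smul_fst, Prod.smul_snd, star_smul, star_smul]; exact hp.2.smul _⟩
  star_mem' {p} hp := ⟨hp.2, by
    rw [Prod.fst_star, Prod.snd_star, star_star, star_star]; exact hp.1⟩

instance : IsClosed (f.intertwiners : Set (AdjEnd A X × AdjEnd B Y)) :=
  f.isClosed_intertwines.inter (f.isClosed_intertwines.preimage continuous_star)

lemma theta_mem_intertwiners (ξ η : X) :
    (theta A ξ η, compEnd (f.ψ ξ) (adjoint (f.ψ η))) ∈ f.intertwiners :=
  ⟨f.intertwines_theta ξ η, by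
    rw [star_theta, star_compEnd_adjoint]; exact f.intertwines_theta η ξ⟩

/-- `S` vanishes on `f.range` and `S⋆` takes its values there, so `S S⋆ = 0` and the C⋆-identity
gives `S = 0`. -/
lemma eq_zero_of_mem_intertwiners {S : AdjEnd B Y} (h : ((0 : AdjEnd A X), S) ∈ f.intertwiners) :
    S = 0 := by
  refine (CStarRing.mul_star_self_eq_zero_iff S).1 (Subtype.ext (ContinuousLinearMap.ext fun y => ?_))
  refine f.eq_zero_of_mem_range (S := (S : Y →L[ℂ] Y)) (fun ξ b => ?_) (h.2.2 y)
  rw [h.1.1]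
  exact (f.intertwines_zero.1 ξ b).symm

lemma eq_of_mem_intertwiners {T : AdjEnd A X} {S S' : AdjEnd B Y} (h : (T, S) ∈ f.intertwiners)
    (h' : (T, S') ∈ f.intertwiners) : S = S' := by
  have := sub_mem h h'
  rw [Prod.mk_sub_mk, sub_self] at this
  exact sub_eq_zero.1 (f.eq_zero_of_mem_intertwiners this)

/-! ### The induced homomorphism on the compacts -/

variable [CompleteSpace X] [CompleteSpace Y]

/-- The C⋆-algebra of intertwining pairs of operators. -/
def Intertwiners : Type _ := f.intertwiners

noncomputable instance : NonUnitalCStarAlgebra f.Intertwiners :=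
  NonUnitalStarSubalgebra.nonUnitalCStarAlgebra f.intertwiners

/-- The first projection, from pairs of intertwining operators to `𝓛(X)`. -/
noncomputable def intertwinersFst : f.Intertwiners →⋆ₙₐ[ℂ] AdjEnd A X where
  toFun p := p.1.1
  map_smul' _ _ := rfl
  map_zero' := rfl
  map_add' _ _ := rfl
  map_mul' _ _ := rfl
  map_star' _ := rfl

lemma intertwinersFst_injective : Function.Injective f.intertwinersFst := by
  rintro ⟨⟨T, S⟩, h⟩ ⟨⟨T', S'⟩, h'⟩ hT
  obtain rfl : T = T' := hT
  obtain rfl := f.eq_of_mem_intertwiners h h'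
  rfl

/-- Every compact operator on `X` induces an operator on `Y`. -/
lemma exists_mem_intertwiners (k : Compacts A X) :
    ∃ S : AdjEnd B Y, (Compacts.incl k, S) ∈ f.intertwiners := by
  -- Isometry makes the set of operators `T` that have a partner `S` closed, so it suffices to find
  -- partners for the rank one operators.
  have hi : Isometry f.intertwinersFst :=
    NonUnitalStarAlgHom.isometry _ f.intertwinersFst_injective
  have hle : compactSpan A X ≤ LinearMap.range (f.intertwinersFst : f.Intertwiners →ₗ[ℂ] _) :=
    compactSpan_le hi.isClosedEmbedding.isClosed_range fun ξ η =>
      ⟨⟨_, f.theta_mem_intertwiners ξ η⟩, rfl⟩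
  obtain ⟨⟨⟨T, S⟩, h⟩, hT⟩ := hle k.incl_mem
  obtain rfl : T = Compacts.incl k := hT
  exact ⟨S, h⟩

/-- The ⋆-homomorphism `𝓚(X) → 𝓛(Y)` induced by a correspondence homomorphism. -/
noncomputable def compactsHom : Compacts A X →⋆ₙₐ[ℂ] AdjEnd B Y where
  toFun k := (f.exists_mem_intertwiners k).choose
  -- The partner of a given operator is unique and the pairs form a ⋆-subalgebra, so the chosen
  -- partners respect all operations.
  map_smul' c k := f.eq_of_mem_intertwiners (f.exists_mem_intertwiners _).choose_spec <| by
    rw [map_smul]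
    exact SMulMemClass.smul_mem c (f.exists_mem_intertwiners k).choose_spec
  map_zero' := f.eq_of_mem_intertwiners (f.exists_mem_intertwiners _).choose_spec <| by
    rw [map_zero]
    exact zero_mem f.intertwiners
  map_add' k l := f.eq_of_mem_intertwiners (f.exists_mem_intertwiners _).choose_spec <| by
    rw [map_add]
    exact add_mem (f.exists_mem_intertwiners k).choose_spec
      (f.exists_mem_intertwiners l).choose_spec
  map_mul' k l := f.eq_of_mem_intertwiners (f.exists_mem_intertwiners _).choose_spec <| by
    rw [map_mul]
    exact mul_mem (f.exists_mem_intertwiners k).choose_spec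
      (f.exists_mem_intertwiners l).choose_spec
  map_star' k := f.eq_of_mem_intertwiners (f.exists_mem_intertwiners _).choose_spec <| by
    rw [map_star]
    exact star_mem (f.exists_mem_intertwiners k).choose_spec

lemma compactsHom_thetaK (ξ η : X) :
    f.compactsHom (thetaK A ξ η) = compEnd (f.ψ ξ) (adjoint (f.ψ η)) :=
  f.eq_of_mem_intertwiners (f.exists_mem_intertwiners _).choose_spec
    (f.theta_mem_intertwiners ξ η)

/-- By automatic continuity only rank one operators matter, and there `T_y T_z⋆ = θ_{y,z}`. -/
lemma compactsHom_mem_compactSpan (h : ∀ ξ : X, ∃ y : Y, f.ψ ξ = multOf y) (k : Compacts A X) :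
    f.compactsHom k ∈ compactSpan B Y := by
  have hc : Continuous f.compactsHom :=
    AddMonoidHomClass.continuous_of_bound f.compactsHom 1 fun k => by
      rw [one_mul]; exact NonUnitalStarAlgHom.norm_apply_le f.compactsHom k
  refine mem_of_thetaK_mem
    (V := (compactSpan B Y).comap (f.compactsHom : Compacts A X →ₗ[ℂ] AdjEnd B Y))
    ((Submodule.isClosed_topologicalClosure _).preimage hc) (fun ξ η => ?_) k
  obtain ⟨y, hy⟩ := h ξ
  obtain ⟨z, hz⟩ := h η
  change f.compactsHom (thetaK A ξ η) ∈ compactSpan B Y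
  rw [compactsHom_thetaK, hy, hz, compEnd_multOf]
  exact theta_mem_compactSpan y z

end CorrHom

/-! ### Uniqueness and the theorem -/

/-- ⋆-homomorphisms on `𝓚(X)` are determined by their values on rank one operators. -/
lemma Compacts.hom_ext {A X C : Type*} [NonUnitalCStarAlgebra A] [PartialOrder A]
    [StarOrderedRing A] [NormedAddCommGroup X] [NormedSpace ℂ X] [SMul Aᵐᵒᵖ X]
    [CStarModule Aᵐᵒᵖ X] [CompleteSpace X] [NonUnitalCStarAlgebra C]
    {φ φ' : Compacts A X →⋆ₙₐ[ℂ] C} (h : ∀ x y : X, φ (thetaK A x y) = φ' (thetaK A x y)) :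
    φ = φ' := by
  -- ⋆-homomorphisms of C⋆-algebras are contractive, so the subspace where `φ` and `φ'` agree is
  -- closed.
  have hc (χ : Compacts A X →⋆ₙₐ[ℂ] C) : Continuous χ :=
    AddMonoidHomClass.continuous_of_bound χ 1 fun k => by
      rw [one_mul]; exact NonUnitalStarAlgHom.norm_apply_le χ k
  ext k
  exact mem_of_thetaK_mem
    (V := LinearMap.eqLocus (φ : Compacts A X →ₗ[ℂ] C) (φ' : Compacts A X →ₗ[ℂ] C))
    (isClosed_eq (hc φ) (hc φ')) h k

end HilbertMod

open HilbertMod in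
theorem proposition2p1 {A B X Y : Type*}
    [NonUnitalCStarAlgebra A] [PartialOrder A] [StarOrderedRing A]
    [NonUnitalCStarAlgebra B] [PartialOrder B] [StarOrderedRing B]
    [NormedAddCommGroup X] [NormedSpace ℂ X] [CompleteSpace X]
    [SMul Aᵐᵒᵖ X] [CStarModule Aᵐᵒᵖ X]
    [NormedAddCommGroup Y] [NormedSpace ℂ Y] [CompleteSpace Y]
    [SMul Bᵐᵒᵖ Y] [CStarModule Bᵐᵒᵖ Y]
    (f : CorrHom A B X Y) :
    ∃ φ : Compacts A X →⋆ₙₐ[ℂ] 𝓜(ℂ, Compacts B Y),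
      (∀ ξ η : X, φ (thetaK A ξ η) = adjToMult (compEnd (f.ψ ξ) (adjoint (f.ψ η)))) ∧
      (∀ φ' : Compacts A X →⋆ₙₐ[ℂ] 𝓜(ℂ, Compacts B Y),
        (∀ ξ η : X, φ' (thetaK A ξ η) = adjToMult (compEnd (f.ψ ξ) (adjoint (f.ψ η)))) → φ' = φ) ∧
      ((∀ ξ : X, ∃ y : Y, f.ψ ξ = multOf y) →
        (∀ k : Compacts A X, ∃ l : Compacts B Y, φ k = DoubleCentralizer.coe ℂ l) ∧
        ∀ (ξ η : X) (y z : Y), f.ψ ξ = multOf y → f.ψ η = multOf z →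
          φ (thetaK A ξ η) = DoubleCentralizer.coe ℂ (thetaK B y z)) := by

  refine ⟨(adjToMultHom B Y).comp f.compactsHom, fun ξ η => ?_, fun φ' h => ?_, fun h =>
    ⟨fun k => ?_, fun ξ η y z hy hz => ?_⟩⟩
  · rw [NonUnitalStarAlgHom.comp_apply, f.compactsHom_thetaK, adjToMultHom_apply]
  -- The competitor `φ'` need not be given as factoring through `𝓛(Y)`: `Compacts.hom_ext` allows
  -- any C⋆-algebra as target.
  · refine Compacts.hom_ext fun ξ η => ?_
    rw [h, NonUnitalStarAlgHom.comp_apply, f.compactsHom_thetaK, adjToMultHom_apply]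
  · exact ⟨Compacts.mk _ (f.compactsHom_mem_compactSpan h k),
      adjToMult_incl (Compacts.mk _ (f.compactsHom_mem_compactSpan h k))⟩
  · rw [NonUnitalStarAlgHom.comp_apply, f.compactsHom_thetaK, adjToMultHom_apply, hy, hz,
      compEnd_multOf]
    exact adjToMult_incl (thetaK B y z)
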